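/- Let $\mathcal C$ be an additive ribbon category: it has finite biproducts, is $\mathbf{Ab}$-enriched with $\mathbb Z$-bilinear tensor product of morphisms, has associator $\alpha$, unit constraints $\lambda,\rho$ and a braiding $\sigma$, each object $X$ has a specified dual $(X^*,\ \mathrm{ev}_X\colon X^*\otimes X\to\mathbb 1,\ \mathrm{coev}_X\colon\mathbb 1\to X\otimes X^*)$, and there is a natural twist $\nu_X\colon X\xrightarrow{\sim} X$ with $\nu_{X\otimes Y}=\sigma_{Y,X}\sigma_{X,Y}(\nu_X\otimes\nu_Y)$ and $(\nu_X\otimes\mathrm{id})\,\mathrm{coev}_X=(\mathrm{id}\otimes\nu_{X^*})\,\mathrm{coev}_X$. Assume that $k=\mathrm{End}(\mathbb 1)$ is a field; then $\mathcal C$ is $k$-linear via $r\cdot f=\lambda_Y\circ(r\otimes f)\circ\lambda_X^{-1}$ for $f\colon X\to Y$. Assume that $\mathcal C$ is finitely semisimple: there is a finite family $(V_j)_{j\in I}$ of objects with $\mathrm{End}(V_j)\cong k$ as $k$-modules and $\mathrm{Hom}(V_j,V_l)=0$ for $j\neq l$, some $V_j$ is isomorphic to $\mathbb 1$, each $V_j^*$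 is isomorphic to some $V_{j'}$, and for every object $X$ there are finitely many morphisms $\imath^X_l\colon V_{j_l}\to X$, $\pi^X_l\colon X\to V_{j_l}$ with $\sum_l\imath^X_l\pi^X_l=\mathrm{id}_X$, $\pi^X_l\imath^X_l=\mathrm{id}$, and $\pi^X_l\imath^X_m=0$ for $l\ne m$; choose such morphisms. For $f\colon X\to X$ let $\mathrm{tr}_X(f)=\mathrm{ev}_X\circ\sigma_{X,X^*}\circ(\nu_X\otimes\mathrm{id})\circ(f\otimes\mathrm{id})\circ\mathrm{coev}_X\in k$, let $\dim X=\mathrm{tr}_X(\mathrm{id}_X)$, and put $D_X=\sum_l(\dim V_{j_l})^{-1}\,\imath^X_l\pi^X_l$ (the numbers $\dim V_j$ are nonzero). Let $\hat V=\bigoplus_{j\in I}V_j$ (any choice of biproduct), and let $\omega\colon\mathcal C\to\mathbf{Vect}_k$ be the long forgetful functor $X\mapsto\mathrm{Hom}(\hat V,\hat V\otimes X)$, $f\mapsto(\mathrm{id}_{\hat V}\otimes f)\circ-$. For $\theta\in\mathrm{Hom}(\hat V\otimes X,\hat V)$ and $v\in\omega(X)$ put $\mathrm{ev}_{\omega(X)}(\theta\otimes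 v)=\mathrm{tr}_{\hat V}(D_{\hat V}\circ\theta\circ v)$. Then for every $X$ there is a pair of finite dual bases $(e_j^{(X)})_j$ of $\mathrm{Hom}(\hat V,\hat V\otimes X)$ and $(e^j_{(X)})_j$ of $\mathrm{Hom}(\hat V\otimes X,\hat V)$ with respect to $\mathrm{ev}_{\omega(X)}$, and $\omega$ has a separable Frobenius structure $(\omega,\omega_{X,Y},\omega_0,\omega^{X,Y},\omega^0)$ given by $$\omega_{X,Y}(f\otimes g)=\alpha_{\hat V,X,Y}\circ(f\otimes\mathrm{id}_Y)\circ g,\qquad \omega_0(1)=\rho_{\hat V}^{-1},$$ $$\omega^{X,Y}(h)=\sum_{j,l}\mathrm{ev}_{\omega(X\otimes Y)}\bigl(e^{jl}_{(X\otimes Y)}\otimes h\bigr)\,e^{(X)}_j\otimes e^{(Y)}_l,\qquad \omega^0(v)=\mathrm{ev}_{\omega(\mathbb 1)}(\rho_{\hat V}\otimes v),$$ where $e^{jl}_{(X\otimes Y)}=e^l_{(Y)}\circ(e^j_{(X)}\otimes\mathrm{id}_Y)\circ\alpha^{-1}_{\hat V,X,Y}$; the formula for $\omega^{X,Y}$ holds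 for every choice of pairs of dual bases for $X$ and for $Y$. Here a separable Frobenius structure means: $(\omega,\omega_{X,Y},\omega_0)$ is lax monoidal, $(\omega,\omega^{X,Y},\omega^0)$ is oplax monoidal, and for all $X,Y,Z$, with $\alpha'$ the associator of $\mathbf{Vect}_k$, $$\omega_{X,Y}\circ\omega^{X,Y}=\mathrm{id}_{\omega(X\otimes Y)},$$ $$\omega^{X,Y\otimes Z}\circ\omega(\alpha_{X,Y,Z})\circ\omega_{X\otimes Y,Z}=(\mathrm{id}_{\omega(X)}\otimes\omega_{Y,Z})\circ\alpha'\circ(\omega^{X,Y}\otimes\mathrm{id}_{\omega(Z)}),$$ $$\omega^{X\otimes Y,Z}\circ\omega(\alpha_{X,Y,Z}^{-1})\circ\omega_{X,Y\otimes Z}=(\omega_{X,Y}\otimes\mathrm{id}_{\omega(Z)})\circ\alpha'^{-1}\circ(\mathrm{id}_{\omega(X)}\otimes\omega^{Y,Z}).$$ -/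

import Mathlib

open CategoryTheory MonoidalCategory Limits
open scoped TensorProduct

universe u v w u' v'

noncomputable section

namespace LongForgetful

/-! ### Functors with separable Frobenius structure -/

/-- The conditions relating the lax monoidal structure `(F, μ, ε)` and the oplax monoidal structure
`(F, δ, η)` of a functor with separable Frobenius structure: `μ` splits `δ`, and the two Frobenius
conditions. -/
structure IsSeparableFrobenius {D : Type u} [Category.{v} D] [MonoidalCategory D]
    {D' : Type u'} [Category.{v'} D'] [MonoidalCategory D'] (F : D ⥤ D')
    (L : F.LaxMonoidal) (O : F.OplaxMonoidal) : Prop where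
  comul_mul : ∀ X Y : D, O.δ X Y ≫ L.μ X Y = 𝟙 (F.obj (X ⊗ Y))
  frobenius_left : ∀ X Y Z : D,
    L.μ (X ⊗ Y) Z ≫ F.map (α_ X Y Z).hom ≫ O.δ X (Y ⊗ Z) =
      O.δ X Y ▷ F.obj Z ≫ (α_ (F.obj X) (F.obj Y) (F.obj Z)).hom ≫ F.obj X ◁ L.μ Y Z
  frobenius_right : ∀ X Y Z : D,
    L.μ X (Y ⊗ Z) ≫ F.map (α_ X Y Z).inv ≫ O.δ (X ⊗ Y) Z =
      F.obj X ◁ O.δ Y Z ≫ (α_ (F.obj X) (F.obj Y) (F.obj Z)).inv ≫ L.μ X Y ▷ F.obj Z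

/-! ### The scalars `k = End(𝟙)` and the `k`-linear structure -/

/-- `k = End(𝟙)`, the elements of which are the endomorphisms `hom : 𝟙 ⟶ 𝟙`.  The wrapper keeps
`k` as a module over itself apart from the `k`-module `Hom(𝟙, 𝟙)`. -/
@[ext]
structure Scalars (C : Type u) [Category.{v} C] [MonoidalCategory C] : Type v where
  hom : 𝟙_ C ⟶ 𝟙_ C

section Scalars

variable {C : Type u} [Category.{v} C] [MonoidalCategory C]

theorem unit_comp_comm (a b : 𝟙_ C ⟶ 𝟙_ C) : a ≫ b = b ≫ a := by
  have ha : a ▷ 𝟙_ C = (ρ_ (𝟙_ C)).hom ≫ a ≫ (ρ_ (𝟙_ C)).inv := by simp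
  have hb : 𝟙_ C ◁ b = (ρ_ (𝟙_ C)).hom ≫ b ≫ (ρ_ (𝟙_ C)).inv := by
    rw [← unitors_equal, ← unitors_inv_equal]; simp
  have h := whisker_exchange a b
  rw [ha, hb] at h
  simp only [Category.assoc, Iso.inv_hom_id_assoc, Iso.cancel_iso_hom_left] at h
  simpa only [← Category.assoc, Iso.cancel_iso_inv_right] using h.symm

variable [Preadditive C]

namespace Scalars

instance : Zero (Scalars C) := ⟨⟨0⟩⟩
instance : One (Scalars C) := ⟨⟨𝟙 (𝟙_ C)⟩⟩
instance : Add (Scalars C) := ⟨fun r s => ⟨r.hom + s.hom⟩⟩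
instance : Neg (Scalars C) := ⟨fun r => ⟨-r.hom⟩⟩
instance : Mul (Scalars C) := ⟨fun r s => ⟨s.hom ≫ r.hom⟩⟩

@[simp] theorem zero_hom : (0 : Scalars C).hom = 0 := rfl
@[simp] theorem one_hom : (1 : Scalars C).hom = 𝟙 (𝟙_ C) := rfl
@[simp] theorem add_hom (r s : Scalars C) : (r + s).hom = r.hom + s.hom := rfl
@[simp] theorem neg_hom (r : Scalars C) : (-r).hom = -r.hom := rfl
@[simp] theorem mul_hom (r s : Scalars C) : (r * s).hom = s.hom ≫ r.hom := rfl

instance : CommRing (Scalars C) where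
  add_assoc r s t := by ext; simp [add_assoc]
  zero_add r := by ext; simp
  add_zero r := by ext; simp
  add_comm r s := by ext; simp [add_comm]
  neg_add_cancel r := by ext; simp
  mul_assoc r s t := by ext; simp
  one_mul r := by ext; simp
  mul_one r := by ext; simp
  zero_mul r := by ext; simp
  mul_zero r := by ext; simp
  left_distrib r s t := by ext; simp
  right_distrib r s t := by ext; simp
  mul_comm r s := by ext; exact unit_comp_comm _ _
  nsmul := nsmulRec
  zsmul := zsmulRec

end Scalars

variable [MonoidalPreadditive C]

/-- The action of `r : 𝟙 ⟶ 𝟙` on `f : X ⟶ Y`, namely `λ_Y ∘ (r ⊗ f) ∘ λ_X⁻¹`. -/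
instance homModule (X Y : C) : Module (Scalars C) (X ⟶ Y) where
  smul r f := (λ_ X).inv ≫ (r.hom ⊗ₘ f) ≫ (λ_ Y).hom
  one_smul f := by
    change (λ_ X).inv ≫ (𝟙 (𝟙_ C) ⊗ₘ f) ≫ (λ_ Y).hom = f
    simp
  mul_smul r s f := by
    change (λ_ X).inv ≫ ((s.hom ≫ r.hom) ⊗ₘ f) ≫ (λ_ Y).hom =
      (λ_ X).inv ≫ (r.hom ⊗ₘ ((λ_ X).inv ≫ (s.hom ⊗ₘ f) ≫ (λ_ Y).hom)) ≫ (λ_ Y).hom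
    rw [unit_comp_comm]
    simp [MonoidalCategory.tensorHom_def]
  smul_zero r := by
    change (λ_ X).inv ≫ (r.hom ⊗ₘ 0) ≫ (λ_ Y).hom = 0
    simp
  smul_add r f g := by
    change (λ_ X).inv ≫ (r.hom ⊗ₘ (f + g)) ≫ (λ_ Y).hom =
      (λ_ X).inv ≫ (r.hom ⊗ₘ f) ≫ (λ_ Y).hom + (λ_ X).inv ≫ (r.hom ⊗ₘ g) ≫ (λ_ Y).hom
    simp [MonoidalPreadditive.tensor_add]
  add_smul r s f := by
    change (λ_ X).inv ≫ ((r.hom + s.hom) ⊗ₘ f) ≫ (λ_ Y).hom =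
      (λ_ X).inv ≫ (r.hom ⊗ₘ f) ≫ (λ_ Y).hom + (λ_ X).inv ≫ (s.hom ⊗ₘ f) ≫ (λ_ Y).hom
    simp [MonoidalPreadditive.add_tensor]
  zero_smul f := by
    change (λ_ X).inv ≫ (0 ⊗ₘ f) ≫ (λ_ Y).hom = 0
    simp

theorem smul_def (r : Scalars C) {X Y : C} (f : X ⟶ Y) :
    r • f = (λ_ X).inv ≫ (r.hom ⊗ₘ f) ≫ (λ_ Y).hom := rfl

theorem smul_def' (r : Scalars C) {X Y : C} (f : X ⟶ Y) :
    r • f = (λ_ X).inv ≫ r.hom ▷ X ≫ (λ_ X).hom ≫ f := by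
  simp [smul_def, MonoidalCategory.tensorHom_def]

instance : Linear (Scalars C) C where
  homModule := homModule
  smul_comp X Y Z r f g := by simp [smul_def']
  comp_smul X Y Z f r g := by
    simp [smul_def, MonoidalCategory.tensorHom_def']

theorem smul_whiskerRight (r : Scalars C) {X Y : C} (f : X ⟶ Y) (Z : C) :
    (r • f) ▷ Z = r • (f ▷ Z) := by
  simp [smul_def']

theorem smul_unit (r : Scalars C) (a : 𝟙_ C ⟶ 𝟙_ C) : r • a = a ≫ r.hom := by
  have h : r.hom ▷ 𝟙_ C = (ρ_ (𝟙_ C)).hom ≫ r.hom ≫ (ρ_ (𝟙_ C)).inv := by simp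
  rw [unit_comp_comm, smul_def', h, unitors_equal, unitors_inv_equal]
  simp

end Scalars

/-! ### Ribbon categories -/

/-- A ribbon structure on a braided monoidal category in which every object `X` has a specified dual
`Xᘁ` with `ev : Xᘁ ⊗ X ⟶ 𝟙` and `coev : 𝟙 ⟶ X ⊗ Xᘁ` (a "right dual" in the terminology of Mathlib,
a "left dual" in that of other authors). -/
class RibbonCategory (C : Type u) [Category.{v} C] [MonoidalCategory C] [BraidedCategory C]
    [RightRigidCategory C] where
  twist : ∀ X : C, X ≅ X
  twist_naturality : ∀ {X Y : C} (f : X ⟶ Y), f ≫ (twist Y).hom = (twist X).hom ≫ f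
  twist_tensor : ∀ X Y : C, (twist (X ⊗ Y)).hom =
    ((twist X).hom ⊗ₘ (twist Y).hom) ≫ (β_ X Y).hom ≫ (β_ Y X).hom
  coev_twist : ∀ X : C, η_ X Xᘁ ≫ (twist X).hom ▷ Xᘁ = η_ X Xᘁ ≫ X ◁ (twist Xᘁ).hom

section Trace

variable {C : Type u} [Category.{v} C] [MonoidalCategory C] [BraidedCategory C]
  [RightRigidCategory C] [RibbonCategory C]

/-- `X ⊗ Xᘁ ⟶ 𝟙`, the evaluation on the other side. -/
def evBar (X : C) : X ⊗ Xᘁ ⟶ 𝟙_ C :=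
  (RibbonCategory.twist X).hom ▷ Xᘁ ≫ (β_ X Xᘁ).hom ≫ ε_ X Xᘁ

/-- The trace of an endomorphism. -/
def tr {X : C} (f : X ⟶ X) : Scalars C := ⟨η_ X Xᘁ ≫ f ▷ Xᘁ ≫ evBar X⟩

/-- The dimension of an object. -/
def dim (X : C) : Scalars C := tr (𝟙 X)

variable [Preadditive C] [MonoidalPreadditive C]

theorem tr_add {X : C} (f g : X ⟶ X) : tr (f + g) = tr f + tr g := by
  ext; simp [tr]

theorem tr_smul {X : C} (r : Scalars C) (f : X ⟶ X) : tr (r • f) = r * tr f := by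
  ext
  rw [Scalars.mul_hom, ← smul_unit]
  simp [tr, smul_whiskerRight]

/-- The trace as a `k`-linear map. -/
def trLinear (X : C) : (X ⟶ X) →ₗ[Scalars C] Scalars C where
  toFun := tr
  map_add' := tr_add
  map_smul' := tr_smul

end Trace

/-! ### Finite semisimplicity -/

section Semisimple

variable (C : Type u) [Category.{v} C] [Preadditive C] [MonoidalCategory C] [MonoidalPreadditive C]

/-- A decomposition of `X` into objects of the family `V`: morphisms `ι_l : V_{j_l} ⟶ X` and
`π_l : X ⟶ V_{j_l}` with `id_X = ∑ ι_l ∘ π_l` and `π_l ∘ ι_m = δ_{lm}`. -/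
structure Decomposition {C : Type u} [Category.{v} C] [Preadditive C] {I : Type w} (V : I → C)
    (X : C) where
  n : ℕ
  idx : Fin n → I
  ι : ∀ l, V (idx l) ⟶ X
  π : ∀ l, X ⟶ V (idx l)
  sum_eq_id : ∑ l, π l ≫ ι l = 𝟙 X
  ι_π_self : ∀ l, ι l ≫ π l = 𝟙 (V (idx l))
  ι_π_ne : ∀ l m, l ≠ m → ι m ≫ π l = 0

/-- A family of simple objects that exhibits the `Ab`-enriched ribbon category `C` as semisimple,
together with chosen decompositions (only their existence is a condition on `C`). -/
structure SemisimpleFamily [RightRigidCategory C] (I : Type w) where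
  V : I → C
  simple : ∀ j, Nonempty ((V j ⟶ V j) ≃ₗ[Scalars C] Scalars C)
  hom_eq_zero : ∀ j l, j ≠ l → ∀ f : V j ⟶ V l, f = 0
  decomposition : ∀ X : C, Decomposition V X
  unit_mem : ∃ j, Nonempty (V j ≅ 𝟙_ C)
  dual_mem : ∀ j, ∃ j', Nonempty (V j' ≅ (V j)ᘁ)

end Semisimple

/-! ### The long forgetful functor -/

section LongForgetful

variable {C : Type u} [Category.{v} C] [Preadditive C] [MonoidalCategory C] [MonoidalPreadditive C]

/-- `X ↦ Hom(V̂, V̂ ⊗ X)`, `f ↦ (id ⊗ f) ∘ -`. -/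
def longForgetful (Vhat : C) : C ⥤ ModuleCat.{v} (Scalars C) where
  obj X := ModuleCat.of (Scalars C) (Vhat ⟶ Vhat ⊗ X)
  map f := ModuleCat.ofHom (Linear.rightComp (Scalars C) Vhat (Vhat ◁ f))
  map_id X := by ext f; simp
  map_comp f g := by ext h; simp

/-- `f ⊗ g ↦ α ∘ (f ⊗ id_Y) ∘ g` as a bilinear map. -/
def mulBilinear (Vhat X Y : C) : (Vhat ⟶ Vhat ⊗ X) →ₗ[Scalars C] (Vhat ⟶ Vhat ⊗ Y) →ₗ[Scalars C]
    (Vhat ⟶ Vhat ⊗ (X ⊗ Y)) :=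
  LinearMap.mk₂ (Scalars C) (fun f g => g ≫ f ▷ Y ≫ (α_ Vhat X Y).hom)
    (fun f f' g => by simp)
    (fun r f g => by simp [smul_whiskerRight])
    (fun f g g' => by simp)
    (fun r f g => by simp)

/-- `ω_{X,Y} : f ⊗ g ↦ α ∘ (f ⊗ id_Y) ∘ g`. -/
def longMul (Vhat X Y : C) :
    (longForgetful Vhat).obj X ⊗ (longForgetful Vhat).obj Y ⟶ (longForgetful Vhat).obj (X ⊗ Y) :=
  ModuleCat.ofHom (TensorProduct.lift (mulBilinear Vhat X Y))

/-- `ω_0 : 1 ↦ ρ⁻¹`. -/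
def longUnit (Vhat : C) : 𝟙_ (ModuleCat.{v} (Scalars C)) ⟶ (longForgetful Vhat).obj (𝟙_ C) :=
  ModuleCat.ofHom
    (LinearMap.toSpanSingleton (Scalars C) (Vhat ⟶ Vhat ⊗ 𝟙_ C) (ρ_ Vhat).inv)

variable [BraidedCategory C] [RightRigidCategory C] [RibbonCategory C]

namespace SemisimpleFamily

variable {I : Type w} (S : SemisimpleFamily C I)

/-- `D_X = ∑ (dim V_{j_l})⁻¹ ι_l ∘ π_l`. -/
def D (X : C) : X ⟶ X :=
  ∑ l, Ring.inverse (dim (S.V ((S.decomposition X).idx l))) •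
    ((S.decomposition X).π l ≫ (S.decomposition X).ι l)

/-- The evaluation `θ ⊗ v ↦ tr(D ∘ θ ∘ v)`, where `Hom(V̂ ⊗ X, V̂)` serves as the dual space of
`Hom(V̂, V̂ ⊗ X)`. -/
def ev (Vhat X : C) (θ : Vhat ⊗ X ⟶ Vhat) : (Vhat ⟶ Vhat ⊗ X) →ₗ[Scalars C] Scalars C :=
  trLinear Vhat ∘ₗ Linear.rightComp (Scalars C) Vhat (θ ≫ S.D Vhat)

theorem ev_apply (Vhat X : C) (θ : Vhat ⊗ X ⟶ Vhat) (v : Vhat ⟶ Vhat ⊗ X) :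
    S.ev Vhat X θ v = tr (v ≫ θ ≫ S.D Vhat) := rfl

/-- A pair of dual bases of `Hom(V̂, V̂ ⊗ X)` and `Hom(V̂ ⊗ X, V̂)`. -/
structure DualBases (Vhat X : C) where
  n : ℕ
  e : Module.Basis (Fin n) (Scalars C) (Vhat ⟶ Vhat ⊗ X)
  e' : Module.Basis (Fin n) (Scalars C) (Vhat ⊗ X ⟶ Vhat)
  pairing : ∀ i j, S.ev Vhat X (e' i) (e j) = if i = j then 1 else 0

/-- `ω^{X,Y} : h ↦ ∑_{j,l} ev(e^{jl} ⊗ h) e_j ⊗ e_l` where `e^{jl} = e^l ∘ (e^j ⊗ id_Y) ∘ α⁻¹`. -/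
def longComul {Vhat X Y : C} (BX : S.DualBases Vhat X) (BY : S.DualBases Vhat Y) :
    (longForgetful Vhat).obj (X ⊗ Y) ⟶ (longForgetful Vhat).obj X ⊗ (longForgetful Vhat).obj Y :=
  ModuleCat.ofHom <| ∑ j, ∑ l,
    (S.ev Vhat (X ⊗ Y) ((α_ Vhat X Y).inv ≫ BX.e' j ▷ Y ≫ BY.e' l)).smulRight
      (BX.e j ⊗ₜ[Scalars C] BY.e l)

/-- `ω^0 : v ↦ ev(ρ ⊗ v)`. -/
def longCounit (Vhat : C) :
    (longForgetful Vhat).obj (𝟙_ C) ⟶ 𝟙_ (ModuleCat.{v} (Scalars C)) :=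
  ModuleCat.ofHom (S.ev Vhat (𝟙_ C) (ρ_ Vhat).hom)

end SemisimpleFamily

end LongForgetful

end LongForgetful

end

noncomputable section

namespace LongForgetful

/-! ### Scalars -/

section Linear

variable {C : Type u} [Category.{v} C] [Preadditive C] [MonoidalCategory C] [MonoidalPreadditive C]

/-! Everything rests on the canonical element `∑ e_j ⊗ e^j` of the trace pairing. It does not depend
on the bases, and a morphism `V̂ ⊗ X ⟶ V̂ ⊗ Y` can be moved from its vector leg to its functional
leg (`sum_bilinear_comp`, `sum_tmul_comp`). Expanding in the second basis turns the double sum for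
`ω^{X,Y}` into `h ↦ ∑ e_j ⊗ (e^j ⊗ id_Y) ∘ α⁻¹ ∘ h` (`longComul_hom`), and the oplax axioms and the
Frobenius conditions become such moves, dual basis expansions, or monoidal coherence.

Semisimplicity supplies the bases and separability. A decomposition of `V̂ ⊗ X`, combined with the
projections and inclusions of `V̂`, gives families which are dual because of the weight `D`
(`exists_dualBases`). They also satisfy `∑ e_j ∘ e^j = id`, an identity that passes to all dual
bases (`sum_e'_comp_e`) and says that multiplication splits comultiplication. The weight inverts
dimensions, which is legitimate by `dim_ne_zero`. -/

theorem whiskerLeft_smul [BraidedCategory C] (r : Scalars C) (X : C) {Y Z : C} (f : Y ⟶ Z) :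
    X ◁ (r • f) = r • (X ◁ f) := by
  -- Scalars act by tensoring on the left, so the braiding is needed to bring the scalar past `X`.
  rw [← cancel_mono (β_ X Z).hom, BraidedCategory.braiding_naturality_right, smul_whiskerRight,
    Linear.comp_smul, Linear.smul_comp, BraidedCategory.braiding_naturality_right]

theorem coevaluation_ne_zero [RightRigidCategory C] {X : C} (hX : 𝟙 X ≠ 0) : η_ X Xᘁ ≠ 0 := by
  intro h
  apply hX
  have := ExactPairing.evaluation_coevaluation X Xᘁ
  rw [h, MonoidalPreadditive.zero_whiskerRight, zero_comp] at this
  rw [← cancel_epi (λ_ X).hom, ← cancel_mono (ρ_ X).inv, Category.comp_id, ← this]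
  simp

theorem exists_eq_smul_id (hk : IsField (Scalars C)) {X : C}
    (φ : (X ⟶ X) ≃ₗ[Scalars C] Scalars C) (f : X ⟶ X) : ∃ r : Scalars C, f = r • 𝟙 X := by
  -- `φ` is only linear, so `φ (𝟙 X)` need not be `1`; being nonzero, hence invertible, suffices.
  have hid : φ (𝟙 X) ≠ 0 := by
    intro h
    obtain ⟨a, b, hab⟩ := hk.exists_pair_ne
    have h0 : 𝟙 X = 0 := by simpa using h
    have hz : ∀ r : Scalars C, r = 0 := fun r => by
      rw [← φ.apply_symm_apply r, ← Category.comp_id (φ.symm r), h0, comp_zero, map_zero]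
    exact hab ((hz a).trans (hz b).symm)
  obtain ⟨s, hs⟩ := hk.mul_inv_cancel hid
  refine ⟨φ f * s, φ.injective ?_⟩
  rw [map_smul, smul_eq_mul, mul_assoc, mul_comm s, hs, mul_one]

/-- If all endomorphisms of `X` are scalars, all morphisms `Xᘁ ⊗ X ⟶ 𝟙` are multiples of the
evaluation. -/
theorem exists_eq_smul_evaluation [BraidedCategory C] [RightRigidCategory C] {X : C}
    (hX : ∀ f : X ⟶ X, ∃ r : Scalars C, f = r • 𝟙 X)
    (q : Xᘁ ⊗ X ⟶ 𝟙_ C) : ∃ r : Scalars C, q = r • ε_ X Xᘁ := by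
  obtain ⟨r, hr⟩ := hX (tensorLeftHomEquiv X X Xᘁ (𝟙_ C) q ≫ (ρ_ X).hom)
  refine ⟨r, ?_⟩
  have h : tensorLeftHomEquiv X X Xᘁ (𝟙_ C) q = r • (ρ_ X).inv := by
    rw [← cancel_mono (ρ_ X).hom, hr, Linear.smul_comp, Iso.inv_hom_id]
  have h' : tensorLeftHomEquiv X X Xᘁ (𝟙_ C) (ε_ X Xᘁ) = (ρ_ X).inv := by
    change (λ_ X).inv ≫ η_ X Xᘁ ▷ X ≫ (α_ X Xᘁ X).hom ≫ X ◁ ε_ X Xᘁ = (ρ_ X).inv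
    rw [ExactPairing.evaluation_coevaluation, Iso.inv_hom_id_assoc]
  have h'' : r • ε_ X Xᘁ =
      (tensorLeftHomEquiv X X Xᘁ (𝟙_ C)).symm (r • (ρ_ X).inv) := by
    rw [← (tensorLeftHomEquiv X X Xᘁ (𝟙_ C)).symm_apply_apply (ε_ X Xᘁ), h']
    change r • (Xᘁ ◁ (ρ_ X).inv ≫ _) = Xᘁ ◁ (r • (ρ_ X).inv) ≫ _
    rw [whiskerLeft_smul, Linear.smul_comp]
  rw [h'', ← h, Equiv.symm_apply_apply]

end Linear

/-! ### Cyclicity of the trace and dimensions of simple objects -/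

section Trace

variable {C : Type u} [Category.{v} C] [MonoidalCategory C] [BraidedCategory C]
  [RightRigidCategory C] [RibbonCategory C]

/-- Naturality of the twist and of the braiding reduces this to the defining property of the mate
`gᘁ`. -/
theorem evBar_naturality {X Y : C} (g : Y ⟶ X) :
    g ▷ Xᘁ ≫ evBar X = Y ◁ gᘁ ≫ evBar Y := by
  have h : g ▷ Xᘁ ≫ (RibbonCategory.twist X).hom ▷ Xᘁ =
      (RibbonCategory.twist Y).hom ▷ Xᘁ ≫ g ▷ Xᘁ := by
    rw [← comp_whiskerRight, RibbonCategory.twist_naturality, comp_whiskerRight]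
  rw [evBar, evBar, reassoc_of% h, BraidedCategory.braiding_naturality_left_assoc,
    ← rightAdjointMate_comp_evaluation, ← BraidedCategory.braiding_naturality_right_assoc,
    whisker_exchange_assoc]

/-- Slide `g` around the loop: it passes `evBar` as `gᘁ` and returns through the coevaluation on the
other side of `f`. -/
theorem tr_comp_comm {X Y : C} (f : X ⟶ Y) (g : Y ⟶ X) : tr (f ≫ g) = tr (g ≫ f) := by
  ext
  change η_ X Xᘁ ≫ (f ≫ g) ▷ Xᘁ ≫ evBar X = η_ Y Yᘁ ≫ (g ≫ f) ▷ Yᘁ ≫ evBar Y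
  rw [comp_whiskerRight, Category.assoc, evBar_naturality, ← whisker_exchange_assoc,
    reassoc_of% coevaluation_comp_rightAdjointMate g, comp_whiskerRight, Category.assoc]

theorem dim_hom (X : C) : (dim X).hom = η_ X Xᘁ ≫ evBar X := by
  simp [dim, tr]

end Trace

/-! ### Dual bases for the pairing -/

section Basis

variable {R M ι : Type*} [CommRing R] [AddCommGroup M] [Module R M] [Fintype ι] [DecidableEq ι]

/-- A spanning family that has a dual family of functionals is a basis. -/
def basisOfDualFamily (e : ι → M) (f : ι → M →ₗ[R] R)
    (hf : ∀ i j, f i (e j) = if i = j then 1 else 0)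
    (he : ∀ m, ∃ c : ι → R, m = ∑ i, c i • e i) : Module.Basis ι R M :=
  Module.Basis.mk (v := e)
    (Fintype.linearIndependent_iff.2 fun g hg i => by
      have := congrArg (f i) hg
      simpa [map_sum, hf] using this)
    (fun m _ => by
      obtain ⟨c, rfl⟩ := he m
      exact Submodule.sum_mem _ fun i _ =>
        Submodule.smul_mem _ _ (Submodule.subset_span ⟨i, rfl⟩))

@[simp]
theorem basisOfDualFamily_apply (e : ι → M) (f : ι → M →ₗ[R] R)
    (hf : ∀ i j, f i (e j) = if i = j then 1 else 0)
    (he : ∀ m, ∃ c : ι → R, m = ∑ i, c i • e i) (i : ι) : basisOfDualFamily e f hf he i = e i := by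
  simp [basisOfDualFamily]

end Basis

/-! ### Consequences of semisimplicity: nonzero dimensions and existence of dual bases. -/

namespace SemisimpleFamily

section Simple

variable {C : Type u} [Category.{v} C] [Preadditive C] [MonoidalCategory C] [MonoidalPreadditive C]
  [RightRigidCategory C] {I : Type w} (S : SemisimpleFamily C I)

theorem id_ne_zero (hk : IsField (Scalars C)) (j : I) : 𝟙 (S.V j) ≠ 0 := by
  intro h
  obtain ⟨φ⟩ := S.simple j
  obtain ⟨r, hr⟩ := exists_eq_smul_id hk φ (φ.symm 1)
  rw [h, smul_zero, LinearEquiv.symm_apply_eq, map_zero] at hr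
  obtain ⟨a, b, hab⟩ := hk.exists_pair_ne
  exact hab (by rw [← mul_one a, ← mul_one b, hr, mul_zero, mul_zero])

/-- A nonzero morphism out of the unit object can be detected by a morphism to the unit object. -/
theorem exists_comp_ne_zero (S : SemisimpleFamily C I) {X : C} (f : 𝟙_ C ⟶ X) (hf : f ≠ 0) : ∃ p : X ⟶ 𝟙_ C, f ≫ p ≠ 0 := by
  obtain ⟨j, ⟨i⟩⟩ := S.unit_mem
  let d := S.decomposition X
  obtain ⟨l, hl⟩ : ∃ l, f ≫ d.π l ≠ 0 := by
    by_contra! h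
    apply hf
    rw [← Category.comp_id f, ← d.sum_eq_id, Preadditive.comp_sum]
    exact Finset.sum_eq_zero fun l _ => by rw [← Category.assoc, h, zero_comp]
  -- A summand that receives a nonzero morphism from the unit object must be the family's copy of
  -- it.
  have hj : j = d.idx l := by
    by_contra hne
    apply hl
    rw [← cancel_epi i.hom, S.hom_eq_zero _ _ hne (i.hom ≫ f ≫ d.π l), comp_zero]
  refine ⟨d.π l ≫ eqToHom (by rw [hj]) ≫ i.hom, fun h => hl ?_⟩
  rw [← Category.assoc] at h
  rw [← cancel_mono (eqToHom (congrArg S.V hj.symm) ≫ i.hom), h, zero_comp]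

theorem exists_eq_smul_π (hk : IsField (Scalars C)) (B : Bicone S.V) (hB : B.IsBilimit) {j : I}
    (f : B.pt ⟶ S.V j) : ∃ r : Scalars C, f = r • B.π j := by
  obtain ⟨φ⟩ := S.simple j
  obtain ⟨r, hr⟩ := exists_eq_smul_id hk φ (B.ι j ≫ f)
  refine ⟨r, hB.isColimit.hom_ext ?_⟩
  rintro ⟨i⟩
  change B.ι i ≫ f = B.ι i ≫ (r • B.π j)
  by_cases h : i = j
  · subst h
    rw [hr, Linear.comp_smul, bicone_ι_π_self]
  · rw [S.hom_eq_zero _ _ h (B.ι i ≫ f), S.hom_eq_zero _ _ h (B.ι i ≫ (r • B.π j))]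

theorem exists_eq_smul_ι (hk : IsField (Scalars C)) (B : Bicone S.V) (hB : B.IsBilimit) {j : I}
    (f : S.V j ⟶ B.pt) : ∃ r : Scalars C, f = r • B.ι j := by
  obtain ⟨φ⟩ := S.simple j
  obtain ⟨r, hr⟩ := exists_eq_smul_id hk φ (f ≫ B.π j)
  refine ⟨r, hB.isLimit.hom_ext ?_⟩
  rintro ⟨i⟩
  change f ≫ B.π i = (r • B.ι j) ≫ B.π i
  by_cases h : j = i
  · subst h
    rw [hr, Linear.smul_comp, bicone_ι_π_self]
  · rw [S.hom_eq_zero _ _ h (f ≫ B.π i), S.hom_eq_zero _ _ h ((r • B.ι j) ≫ B.π i)]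

end Simple

variable {C : Type u} [Category.{v} C] [Preadditive C] [MonoidalCategory C] [MonoidalPreadditive C]
  [BraidedCategory C] [RightRigidCategory C] [RibbonCategory C] {I : Type w}
  (S : SemisimpleFamily C I)

/-- The coevaluation is nonzero, so some `p : V_j ⊗ V_jᘁ ⟶ 𝟙` detects it. All such `p` are multiples
of `evBar`, hence `p ∘ coev` is a multiple of the dimension. -/
theorem dim_ne_zero (hk : IsField (Scalars C)) (j : I) : dim (S.V j) ≠ 0 := by
  intro h
  obtain ⟨φ⟩ := S.simple j
  have hend := exists_eq_smul_id hk φ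
  obtain ⟨p, hp⟩ := S.exists_comp_ne_zero _ (coevaluation_ne_zero (S.id_ne_zero hk j))
  obtain ⟨t, ht⟩ := hend (RibbonCategory.twist (S.V j)).inv
  obtain ⟨r, hr⟩ := exists_eq_smul_evaluation hend ((β_ (S.V j) (S.V j)ᘁ).inv ≫ p)
  -- The braided evaluation and `evBar` differ by the twist, which is a scalar on a simple object.
  have hε : (β_ (S.V j) (S.V j)ᘁ).hom ≫ ε_ (S.V j) (S.V j)ᘁ = t • evBar (S.V j) := by
    have : (RibbonCategory.twist (S.V j)).inv ▷ (S.V j)ᘁ ≫ evBar (S.V j) =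
        (β_ (S.V j) (S.V j)ᘁ).hom ≫ ε_ (S.V j) (S.V j)ᘁ := by
      simp [evBar]
    rw [← this, ht, smul_whiskerRight, id_whiskerRight, Linear.smul_comp, Category.id_comp]
  apply hp
  rw [(Iso.inv_comp_eq _).1 hr, Linear.comp_smul, hε, Linear.comp_smul, Linear.comp_smul,
    ← dim_hom, h, Scalars.zero_hom, smul_zero, smul_zero]

theorem inverse_dim_mul (hk : IsField (Scalars C)) (j : I) :
    Ring.inverse (dim (S.V j)) * dim (S.V j) = 1 := by
  obtain ⟨b, hb⟩ := hk.mul_inv_cancel (S.dim_ne_zero hk j)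
  exact Ring.inverse_mul_cancel _ (IsUnit.of_mul_eq_one b hb)

/-- Only summands isomorphic to `V_j` meet the image of `f`, and `D` has the same weight on all of
them. -/
theorem comp_D {X : C} {j : I} (f : S.V j ⟶ X) :
    f ≫ S.D X = Ring.inverse (dim (S.V j)) • f := by
  let d := S.decomposition X
  have h : ∀ l, f ≫ (Ring.inverse (dim (S.V (d.idx l))) • (d.π l ≫ d.ι l)) =
      Ring.inverse (dim (S.V j)) • (f ≫ d.π l ≫ d.ι l) := by
    intro l
    rw [Linear.comp_smul]
    by_cases hj : j = d.idx l
    · rw [show dim (S.V (d.idx l)) = dim (S.V j) by rw [hj]]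
    · rw [← Category.assoc, S.hom_eq_zero _ _ hj (f ≫ d.π l), zero_comp, smul_zero, smul_zero]
  rw [D, Preadditive.comp_sum, Finset.sum_congr rfl fun l _ => h l, ← Finset.smul_sum,
    ← Preadditive.comp_sum, d.sum_eq_id, Category.comp_id]

theorem tr_comp_D (hk : IsField (Scalars C)) {X : C} {j : I} (p : X ⟶ S.V j) (i : S.V j ⟶ X)
    (h : i ≫ p = 𝟙 (S.V j)) : tr (p ≫ i ≫ S.D X) = 1 := by
  rw [comp_D, Linear.comp_smul, tr_smul, tr_comp_comm, h]
  exact S.inverse_dim_mul hk j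

/-- `θ ↦ ev(θ ⊗ v)` as a linear map. -/
def evFlip (Vhat X : C) (v : Vhat ⟶ Vhat ⊗ X) : (Vhat ⊗ X ⟶ Vhat) →ₗ[Scalars C] Scalars C :=
  trLinear Vhat ∘ₗ Linear.rightComp (Scalars C) Vhat (S.D Vhat) ∘ₗ
    Linear.leftComp (Scalars C) Vhat v

theorem evFlip_apply (Vhat X : C) (v : Vhat ⟶ Vhat ⊗ X) (θ : Vhat ⊗ X ⟶ Vhat) :
    S.evFlip Vhat X v θ = S.ev Vhat X θ v := by
  rw [ev_apply, ← Category.assoc]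
  rfl

/-- Each summand `V_j` of `B.pt ⊗ X` gives one vector, by projecting `B.pt` to `V_j` and including,
and one functional, by going back. -/
theorem exists_dualBases (hk : IsField (Scalars C)) (B : Bicone S.V) (hB : B.IsBilimit) (X : C) :
    ∃ b : S.DualBases B.pt X, ∑ l, b.e' l ≫ b.e l = 𝟙 (B.pt ⊗ X) := by
  let d := S.decomposition (B.pt ⊗ X)
  let e : Fin d.n → (B.pt ⟶ B.pt ⊗ X) := fun l => B.π (d.idx l) ≫ d.ι l
  let e' : Fin d.n → (B.pt ⊗ X ⟶ B.pt) := fun l => d.π l ≫ B.ι (d.idx l)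
  have hp : ∀ i j, S.ev B.pt X (e' i) (e j) = if i = j then 1 else 0 := by
    intro i j
    rw [ev_apply]
    split_ifs with h
    · subst h
      simp only [e, e', Category.assoc]
      rw [← Category.assoc (d.ι i), d.ι_π_self, Category.id_comp]
      exact S.tr_comp_D hk _ _ (bicone_ι_π_self _ _)
    · simp only [e, e', Category.assoc]
      rw [← Category.assoc (d.ι j), d.ι_π_ne i j h, zero_comp, comp_zero]
      exact map_zero (trLinear B.pt)
  refine ⟨⟨d.n, basisOfDualFamily e (fun i => S.ev B.pt X (e' i)) hp ?_,
    basisOfDualFamily e' (fun i => S.evFlip B.pt X (e i)) (fun i j => ?_) ?_, fun i j => ?_⟩, ?_⟩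
  · intro v
    -- Each component of `v` is a morphism from `B.pt` to a simple object, hence a multiple of the
    -- projection.
    choose c hc using fun l => S.exists_eq_smul_π hk B hB (v ≫ d.π l)
    refine ⟨c, ?_⟩
    conv_lhs => rw [← Category.comp_id v, ← d.sum_eq_id, Preadditive.comp_sum]
    exact Finset.sum_congr rfl fun l _ => by rw [← Category.assoc, hc, Linear.smul_comp]
  · rw [evFlip_apply, hp]
    simp only [eq_comm]
  · intro θ
    choose c hc using fun l => S.exists_eq_smul_ι hk B hB (d.ι l ≫ θ)
    refine ⟨c, ?_⟩
    conv_lhs => rw [← Category.id_comp θ, ← d.sum_eq_id, Preadditive.sum_comp]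
    exact Finset.sum_congr rfl fun l _ => by rw [Category.assoc, hc, Linear.comp_smul]
  · simp only [basisOfDualFamily_apply]
    exact hp i j
  · simp only [basisOfDualFamily_apply, e, e']
    refine (Finset.sum_congr rfl fun l _ => ?_).trans d.sum_eq_id
    rw [Category.assoc, ← Category.assoc (B.ι _), bicone_ι_π_self, Category.id_comp]

end SemisimpleFamily

/-! ### The calculus of dual bases and the comultiplication -/

section Linear

variable {C : Type u} [Category.{v} C] [Preadditive C] [MonoidalCategory C] [MonoidalPreadditive C]
  {V X Y : C}

/-- `θ ↦ (θ ⊗ id_Y) ∘ α⁻¹ ∘ h`. -/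
def contract (h : V ⟶ V ⊗ (X ⊗ Y)) : (V ⊗ X ⟶ V) →ₗ[Scalars C] (V ⟶ V ⊗ Y) where
  toFun θ := h ≫ (α_ V X Y).inv ≫ θ ▷ Y
  map_add' θ θ' := by simp
  map_smul' r θ := by simp [smul_whiskerRight]

theorem contract_apply (h : V ⟶ V ⊗ (X ⊗ Y)) (θ : V ⊗ X ⟶ V) :
    contract h θ = h ≫ (α_ V X Y).inv ≫ θ ▷ Y := rfl

variable (V) in
/-- `ω(f)` as a linear map. -/
abbrev mapLinear (f : X ⟶ Y) : (V ⟶ V ⊗ X) →ₗ[Scalars C] (V ⟶ V ⊗ Y) :=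
  Linear.rightComp (Scalars C) V (V ◁ f)

/-- The multiplication as a linear map. -/
abbrev mulLinear (V X Y : C) : (V ⟶ V ⊗ X) ⊗[Scalars C] (V ⟶ V ⊗ Y) →ₗ[Scalars C]
    (V ⟶ V ⊗ (X ⊗ Y)) :=
  TensorProduct.lift (mulBilinear V X Y)

theorem mulLinear_tmul (f : V ⟶ V ⊗ X) (g : V ⟶ V ⊗ Y) :
    mulLinear V X Y (f ⊗ₜ g) = g ≫ f ▷ Y ≫ (α_ V X Y).hom := rfl

end Linear

namespace SemisimpleFamily

variable {C : Type u} [Category.{v} C] [Preadditive C] [MonoidalCategory C] [MonoidalPreadditive C]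
  [BraidedCategory C] [RightRigidCategory C] [RibbonCategory C] {I : Type w}
  {S : SemisimpleFamily C I} {V X Y Z : C}

theorem ev_comp (f : V ⊗ X ⟶ V ⊗ Y) (θ : V ⊗ Y ⟶ V) (v : V ⟶ V ⊗ X) :
    S.ev V X (f ≫ θ) v = S.ev V Y θ (v ≫ f) := by
  simp only [ev_apply, Category.assoc]

theorem sum_ev_smul_e (b : S.DualBases V X) (v : V ⟶ V ⊗ X) :
    ∑ l, S.ev V X (b.e' l) v • b.e l = v := by
  have h : ∀ l, S.ev V X (b.e' l) v = b.e.repr v l := fun l => by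
    conv_lhs => rw [← b.e.sum_repr v]
    simp only [map_sum, map_smul, b.pairing, smul_eq_mul, mul_ite, mul_one, mul_zero,
      Finset.sum_ite_eq, Finset.mem_univ, if_true]
  simp only [h, b.e.sum_repr]

theorem sum_ev_smul_e' (b : S.DualBases V X) (θ : V ⊗ X ⟶ V) :
    ∑ l, S.ev V X θ (b.e l) • b.e' l = θ := by
  have h : ∀ l, S.ev V X θ (b.e l) = b.e'.repr θ l := fun l => by
    rw [← evFlip_apply]
    conv_lhs => rw [← b.e'.sum_repr θ]
    simp only [map_sum, map_smul, evFlip_apply, b.pairing, smul_eq_mul, mul_ite, mul_one, mul_zero,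
      Finset.sum_ite_eq', Finset.mem_univ, if_true]
  simp only [h, b.e'.sum_repr]

/-- The canonical element `∑ e_j ⊗ e^j` is dinatural in `X`; in particular it does not depend on the
pair of dual bases. -/
theorem sum_bilinear_comp {M : Type*} [AddCommGroup M] [Module (Scalars C) M]
    (b : S.DualBases V X) (d : S.DualBases V Y) (g : V ⊗ X ⟶ V ⊗ Y)
    (Φ : (V ⟶ V ⊗ Y) →ₗ[Scalars C] (V ⊗ X ⟶ V) →ₗ[Scalars C] M) :
    ∑ j, Φ (b.e j ≫ g) (b.e' j) = ∑ l, Φ (d.e l) (g ≫ d.e' l) := by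
  -- Both sides expand into the same double sum, with the matrix coefficients of `g` in the two
  -- pairs of bases.
  have h₁ : ∀ j, Φ (b.e j ≫ g) (b.e' j) =
      ∑ l, S.ev V Y (d.e' l) (b.e j ≫ g) • Φ (d.e l) (b.e' j) := fun j => by
    conv_lhs => rw [← sum_ev_smul_e d (b.e j ≫ g)]
    simp
  have h₂ : ∀ l, Φ (d.e l) (g ≫ d.e' l) =
      ∑ j, S.ev V Y (d.e' l) (b.e j ≫ g) • Φ (d.e l) (b.e' j) := fun l => by
    conv_lhs => rw [← sum_ev_smul_e' b (g ≫ d.e' l)]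
    simp [ev_comp]
  simp only [h₁, h₂]
  exact Finset.sum_comm

theorem sum_tmul_comp {M : Type*} [AddCommGroup M] [Module (Scalars C) M]
    (b : S.DualBases V X) (d : S.DualBases V Y) (g : V ⊗ X ⟶ V ⊗ Y)
    (F : (V ⊗ X ⟶ V) →ₗ[Scalars C] M) :
    ∑ j, (b.e j ≫ g) ⊗ₜ[Scalars C] F (b.e' j) = ∑ l, d.e l ⊗ₜ[Scalars C] F (g ≫ d.e' l) :=
  sum_bilinear_comp b d g ((TensorProduct.mk (Scalars C) (V ⟶ V ⊗ Y) M).compl₂ F)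

theorem sum_e'_comp_e (hk : IsField (Scalars C)) (B : Bicone S.V) (hB : B.IsBilimit)
    (b : S.DualBases B.pt X) : ∑ l, b.e' l ≫ b.e l = 𝟙 (B.pt ⊗ X) := by
  obtain ⟨d, hd⟩ := S.exists_dualBases hk B hB X
  -- Composition is bilinear, so its value on the canonical element can be computed in the bases
  -- `d`.
  have := sum_bilinear_comp b d (𝟙 _) (LinearMap.flip (Linear.comp (S := Scalars C) _ _ _))
  simpa [hd] using this

/-- The comultiplication `h ↦ ∑ e_j ⊗ (e^j ⊗ id_Y) ∘ α⁻¹ ∘ h`. -/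
def comulLinear (b : S.DualBases V X) (Y : C) : (V ⟶ V ⊗ (X ⊗ Y)) →ₗ[Scalars C]
    (V ⟶ V ⊗ X) ⊗[Scalars C] (V ⟶ V ⊗ Y) :=
  ∑ j, TensorProduct.mk (Scalars C) _ _ (b.e j) ∘ₗ
    Linear.rightComp (Scalars C) V ((α_ V X Y).inv ≫ b.e' j ▷ Y)

theorem comulLinear_apply (b : S.DualBases V X) (h : V ⟶ V ⊗ (X ⊗ Y)) :
    comulLinear b Y h = ∑ j, b.e j ⊗ₜ[Scalars C] contract h (b.e' j) := by
  simp [comulLinear, contract_apply]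

/-- The sum over `l` is the expansion of the contracted morphism in the basis `d.e`, so `d` drops
out. -/
theorem longComul_hom (b : S.DualBases V X) (d : S.DualBases V Y) :
    (S.longComul b d).hom = comulLinear b Y := by
  have key : ∀ h, (∑ j, ∑ l, (S.ev V (X ⊗ Y) ((α_ V X Y).inv ≫ b.e' j ▷ Y ≫ d.e' l)).smulRight
      (b.e j ⊗ₜ[Scalars C] d.e l)) h = comulLinear b Y h := fun h => ?_
  · exact LinearMap.ext key
  rw [comulLinear_apply]
  simp only [LinearMap.sum_apply, LinearMap.smulRight_apply]
  refine Finset.sum_congr rfl fun j _ => ?_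
  rw [← sum_ev_smul_e d (contract h (b.e' j)), TensorProduct.tmul_sum]
  refine Finset.sum_congr rfl fun l _ => ?_
  rw [TensorProduct.tmul_smul, contract_apply, ← ev_comp, Category.assoc]

theorem comulLinear_eq (b b' : S.DualBases V X) (Y : C) : comulLinear b Y = comulLinear b' Y := by
  refine LinearMap.ext fun h => ?_
  simpa [comulLinear_apply] using sum_tmul_comp b b' (𝟙 _) (contract h)

theorem comulLinear_natural_left {X' : C} (b : S.DualBases V X) (b' : S.DualBases V X')
    (f : X ⟶ X') (h : V ⟶ V ⊗ (X ⊗ Y)) :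
    (mapLinear V f).rTensor _ (comulLinear b Y h) = comulLinear b' Y (h ≫ V ◁ f ▷ Y) := by
  simp only [comulLinear_apply, map_sum, LinearMap.rTensor_tmul, Linear.rightComp_apply]
  rw [sum_tmul_comp b b' (V ◁ f) (contract h)]
  simp [contract_apply]

theorem comulLinear_natural_right {Y' : C} (b : S.DualBases V X) (f : Y ⟶ Y')
    (h : V ⟶ V ⊗ (X ⊗ Y)) :
    (mapLinear V f).lTensor _ (comulLinear b Y h) = comulLinear b Y' (h ≫ V ◁ X ◁ f) := by
  simp only [comulLinear_apply, map_sum, LinearMap.lTensor_tmul, Linear.rightComp_apply]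
  simp [contract_apply, ← whisker_exchange]

/-- For each `j`, the morphism `(e^j ⊗ id_Y) ∘ α⁻¹` is moved across the canonical element, trading
the bases for `X ⊗ Y` for those for `Y`. -/
theorem comulLinear_coassoc (b : S.DualBases V X) (d : S.DualBases V Y)
    (c : S.DualBases V (X ⊗ Y)) (h : V ⟶ V ⊗ ((X ⊗ Y) ⊗ Z)) :
    TensorProduct.assoc (Scalars C) _ _ _ ((comulLinear b Y).rTensor _ (comulLinear c Z h)) =
      (comulLinear d Z).lTensor _ (comulLinear b (Y ⊗ Z) (h ≫ V ◁ (α_ X Y Z).hom)) := by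
  simp only [comulLinear_apply, map_sum, LinearMap.rTensor_tmul, LinearMap.lTensor_tmul,
    TensorProduct.sum_tmul, TensorProduct.tmul_sum, TensorProduct.assoc_tmul]
  rw [Finset.sum_comm]
  refine Finset.sum_congr rfl fun j _ => ?_
  have := sum_tmul_comp c d ((α_ V X Y).inv ≫ b.e' j ▷ Y) (contract h)
  simp only [← TensorProduct.tmul_sum]
  simp only [contract_apply (X := X) (Y := Y), this]
  simp [contract_apply]

theorem comulLinear_counit_left (b : S.DualBases V (𝟙_ C)) (v : V ⟶ V ⊗ Y) :
    (S.ev V (𝟙_ C) (ρ_ V).hom).rTensor _ (comulLinear b Y (v ≫ V ◁ (λ_ Y).inv)) =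
      (TensorProduct.lid (Scalars C) _).symm v := by
  rw [LinearEquiv.eq_symm_apply]
  simp only [comulLinear_apply, map_sum, LinearMap.rTensor_tmul, TensorProduct.lid_tmul]
  simp only [← map_smul, ← map_sum]
  -- The coefficients `ev(ρ ⊗ e_j)` reassemble `ρ` from the `e^j`.
  rw [sum_ev_smul_e', contract_apply]
  simp

theorem comulLinear_counit_right (b : S.DualBases V X) (v : V ⟶ V ⊗ X) :
    (S.ev V (𝟙_ C) (ρ_ V).hom).lTensor _ (comulLinear b (𝟙_ C) (v ≫ V ◁ (ρ_ X).inv)) =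
      (TensorProduct.rid (Scalars C) _).symm v := by
  rw [LinearEquiv.eq_symm_apply]
  simp only [comulLinear_apply, map_sum, LinearMap.lTensor_tmul, TensorProduct.rid_tmul]
  conv_rhs => rw [← sum_ev_smul_e b v]
  refine Finset.sum_congr rfl fun j _ => ?_
  rw [contract_apply]
  congr 1
  rw [ev_apply, ev_apply]
  simp

theorem mulLinear_comulLinear (hk : IsField (Scalars C)) (B : Bicone S.V) (hB : B.IsBilimit)
    (b : S.DualBases B.pt X) (h : B.pt ⟶ B.pt ⊗ (X ⊗ Y)) :
    mulLinear B.pt X Y (comulLinear b Y h) = h := by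
  simp only [comulLinear_apply, map_sum, mulLinear_tmul, contract_apply, Category.assoc]
  simp only [← comp_whiskerRight_assoc, ← Preadditive.comp_sum, ← Preadditive.sum_comp]
  rw [← sum_whiskerRight, sum_e'_comp_e hk B hB]
  simp

/-- Contraction affects only the factor `f`, so the two sides agree term by term. -/
theorem comulLinear_mulLinear_left (b : S.DualBases V X) (f : V ⟶ V ⊗ (X ⊗ Y)) (g : V ⟶ V ⊗ Z) :
    comulLinear b (Y ⊗ Z) (mulLinear V (X ⊗ Y) Z (f ⊗ₜ g) ≫ V ◁ (α_ X Y Z).hom) =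
      (mulLinear V Y Z).lTensor _
        (TensorProduct.assoc (Scalars C) _ _ _ (comulLinear b Y f ⊗ₜ g)) := by
  simp only [comulLinear_apply, TensorProduct.sum_tmul, map_sum, TensorProduct.assoc_tmul,
    LinearMap.lTensor_tmul, mulLinear_tmul, contract_apply]
  simp

theorem comulLinear_mulLinear_right (c : S.DualBases V (X ⊗ Y)) (d : S.DualBases V Y)
    (f : V ⟶ V ⊗ X) (g : V ⟶ V ⊗ (Y ⊗ Z)) :
    comulLinear c Z (mulLinear V X (Y ⊗ Z) (f ⊗ₜ g) ≫ V ◁ (α_ X Y Z).inv) =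
      (mulLinear V X Y).rTensor _
        ((TensorProduct.assoc (Scalars C) _ _ _).symm (f ⊗ₜ comulLinear d Z g)) := by
  simp only [comulLinear_apply, TensorProduct.tmul_sum, map_sum, TensorProduct.assoc_symm_tmul,
    LinearMap.rTensor_tmul, mulLinear_tmul]
  -- Multiplying the vectors `e_l` by `f` is composition with this morphism, which moves to the
  -- functional leg.
  rw [sum_tmul_comp d c (f ▷ Y ≫ (α_ V X Y).hom) (contract g)]
  simp [contract_apply]

end SemisimpleFamily

/-! ### The lax and the oplax monoidal structure -/

section Lax

variable {C : Type u} [Category.{v} C] [Preadditive C] [MonoidalCategory C] [MonoidalPreadditive C]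
  (V : C) {X Y Z : C}

theorem mulLinear_natural_left {X' : C} (f : X ⟶ X') (a : V ⟶ V ⊗ X) (b : V ⟶ V ⊗ Y) :
    mulLinear V X' Y ((a ≫ V ◁ f) ⊗ₜ b) = mulLinear V X Y (a ⊗ₜ b) ≫ V ◁ f ▷ Y := by
  simp only [mulLinear_tmul]
  simp

theorem mulLinear_natural_right {Y' : C} (f : Y ⟶ Y') (a : V ⟶ V ⊗ X) (b : V ⟶ V ⊗ Y) :
    mulLinear V X Y' (a ⊗ₜ (b ≫ V ◁ f)) = mulLinear V X Y (a ⊗ₜ b) ≫ V ◁ X ◁ f := by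
  simp only [mulLinear_tmul]
  simp [whisker_exchange_assoc]

theorem mulLinear_assoc (a : V ⟶ V ⊗ X) (b : V ⟶ V ⊗ Y) (c : V ⟶ V ⊗ Z) :
    mulLinear V (X ⊗ Y) Z (mulLinear V X Y (a ⊗ₜ b) ⊗ₜ c) ≫ V ◁ (α_ X Y Z).hom =
      mulLinear V X (Y ⊗ Z) (a ⊗ₜ mulLinear V Y Z (b ⊗ₜ c)) := by
  simp only [mulLinear_tmul]
  simp

theorem mulLinear_one_left (r : Scalars C) (b : V ⟶ V ⊗ Y) :
    mulLinear V (𝟙_ C) Y ((r • (ρ_ V).inv) ⊗ₜ b) ≫ V ◁ (λ_ Y).hom = r • b := by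
  simp only [mulLinear_tmul]
  simp [smul_whiskerRight]

theorem mulLinear_one_right (r : Scalars C) (a : V ⟶ V ⊗ X) :
    mulLinear V X (𝟙_ C) (a ⊗ₜ (r • (ρ_ V).inv)) ≫ V ◁ (ρ_ X).hom = r • a := by
  simp only [mulLinear_tmul]
  simp

/-- The lax monoidal structure of the long forgetful functor. -/
@[reducible]
def laxMonoidal : (longForgetful V).LaxMonoidal where
  ε := longUnit V
  μ X Y := longMul V X Y
  μ_natural_left f _ := ModuleCat.MonoidalCategory.tensor_ext fun a b =>
    mulLinear_natural_left V f a b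
  μ_natural_right _ f := ModuleCat.MonoidalCategory.tensor_ext fun a b =>
    mulLinear_natural_right V f a b
  associativity _ _ _ := ModuleCat.MonoidalCategory.tensor_ext₃' fun a b c =>
    mulLinear_assoc V a b c
  left_unitality _ := ModuleCat.MonoidalCategory.tensor_ext fun r b =>
    (mulLinear_one_left V r b).symm
  right_unitality _ := ModuleCat.MonoidalCategory.tensor_ext fun a r =>
    (mulLinear_one_right V r a).symm

end Lax

namespace SemisimpleFamily

variable {C : Type u} [Category.{v} C] [Preadditive C] [MonoidalCategory C] [MonoidalPreadditive C]
  [BraidedCategory C] [RightRigidCategory C] [RibbonCategory C] {I : Type w}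
  {S : SemisimpleFamily C I} {V : C}

theorem longComul_eq {X Y : C} (b : S.DualBases V X) (d : S.DualBases V Y) :
    S.longComul b d = ModuleCat.ofHom (comulLinear b Y) :=
  ModuleCat.hom_ext (longComul_hom b d)

/-- The oplax monoidal structure of the long forgetful functor. -/
@[reducible]
def oplaxMonoidal (b : ∀ X, S.DualBases V X) : (longForgetful V).OplaxMonoidal where
  η := S.longCounit V
  δ X Y := ModuleCat.ofHom (comulLinear (b X) Y)
  δ_natural_left f _ := ModuleCat.hom_ext <| LinearMap.ext fun h =>
    comulLinear_natural_left (b _) (b _) f h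
  δ_natural_right _ f := ModuleCat.hom_ext <| LinearMap.ext fun h =>
    comulLinear_natural_right (b _) f h
  oplax_associativity X Y _ := ModuleCat.hom_ext <| LinearMap.ext fun h =>
    comulLinear_coassoc (b X) (b Y) (b (X ⊗ Y)) h
  oplax_left_unitality _ := ModuleCat.hom_ext <| LinearMap.ext fun v =>
    (comulLinear_counit_left (b (𝟙_ C)) v).symm
  oplax_right_unitality X := ModuleCat.hom_ext <| LinearMap.ext fun v =>
    (comulLinear_counit_right (b X) v).symm

theorem isSeparableFrobenius (hk : IsField (Scalars C)) (B : Bicone S.V) (hB : B.IsBilimit)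
    (b : ∀ X, S.DualBases B.pt X) :
    IsSeparableFrobenius (longForgetful B.pt) (laxMonoidal B.pt) (oplaxMonoidal b) where
  comul_mul X _ := ModuleCat.hom_ext <| LinearMap.ext fun h =>
    mulLinear_comulLinear hk B hB (b X) h
  frobenius_left X _ _ := ModuleCat.MonoidalCategory.tensor_ext fun f g =>
    comulLinear_mulLinear_left (b X) f g
  frobenius_right X Y _ := ModuleCat.MonoidalCategory.tensor_ext fun f g =>
    comulLinear_mulLinear_right (b (X ⊗ Y)) (b Y) f g

end SemisimpleFamily

end LongForgetful

end

theorem mainTheorem9 {C : Type u} [Category.{v} C] [Preadditive C] [MonoidalCategory C]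
    [MonoidalPreadditive C] [HasFiniteBiproducts C] [BraidedCategory C] [RightRigidCategory C]
    [LongForgetful.RibbonCategory C] (hk : IsField (LongForgetful.Scalars C))
    {I : Type w} [Finite I] (S : LongForgetful.SemisimpleFamily C I)
    (Vhat : Bicone S.V) (hV : Vhat.IsBilimit) :
    (∀ X : C, Nonempty (S.DualBases Vhat.pt X)) ∧
    ∃ (L : (LongForgetful.longForgetful Vhat.pt).LaxMonoidal)
      (O : (LongForgetful.longForgetful Vhat.pt).OplaxMonoidal),
      LongForgetful.IsSeparableFrobenius (LongForgetful.longForgetful Vhat.pt) L O ∧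
      (∀ X Y : C, L.μ X Y = LongForgetful.longMul Vhat.pt X Y) ∧
      L.ε = LongForgetful.longUnit Vhat.pt ∧
      (∀ (X Y : C) (BX : S.DualBases Vhat.pt X) (BY : S.DualBases Vhat.pt Y),
        O.δ X Y = S.longComul BX BY) ∧
      O.η = S.longCounit Vhat.pt := by
  have hb : ∀ X : C, Nonempty (S.DualBases Vhat.pt X) := fun X =>
    ⟨(S.exists_dualBases hk Vhat hV X).choose⟩
  refine ⟨hb, LongForgetful.laxMonoidal Vhat.pt,
    LongForgetful.SemisimpleFamily.oplaxMonoidal fun X => (hb X).some,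
    LongForgetful.SemisimpleFamily.isSeparableFrobenius hk Vhat hV _, fun _ _ => rfl, rfl,
    fun X Y BX BY => ?_, rfl⟩
  -- The structure was built from arbitrarily chosen dual bases; independence of the choice covers
  -- all others.
  rw [LongForgetful.SemisimpleFamily.longComul_eq BX BY,
    LongForgetful.SemisimpleFamily.comulLinear_eq BX (hb X).some Y]
  rfl
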